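/- Let $A\in\mathbb{R}^{n\times n}$, $B\in\mathbb{R}^{n\times m}$, $S\in\mathbb{R}^{m\times n}$, and let $Q\in\mathbb{R}^{n\times n}$ and $R\in\mathbb{R}^{m\times m}$ be symmetric. Assume that: (i) $(A,B)$ is controllable, i.e. $\operatorname{rank}[\,B\ \ AB\ \cdots\ A^{n-1}B\,]=n$; (ii) quadratic strict $(x,u)$-pre-dissipativity holds, i.e. there are a matrix $\Lambda\in\mathbb{R}^{n\times n}$ and a scalar $\epsilon>0$ such that for all $x\in\mathbb{R}^n$ and $u\in\mathbb{R}^m$ $$\begin{pmatrix}x\\u\end{pmatrix}^{\!\top}\begin{pmatrix}Q+\Lambda-A^\top\Lambda A & S^\top-A^\top\Lambda B\\ S-B^\top\Lambda A & R-B^\top\Lambda B\end{pmatrix}\begin{pmatrix}x\\u\end{pmatrix}\ \ge\ \epsilon\,(\|x\|^2+\|u\|^2).$$ Let $\hat K\in\mathbb{R}^{m\times n}$ be any matrix such that $A_{\hat K}:=A-B\hat K$ is invertible, put $S_{\hat K}:=S-R\hat K$, and assume that $D:=R-S_{\hat K}A_{\hat K}^{-1}B$ is invertible. Then the antistabilizing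 solution of the discrete algebraic Riccati equation (DARE) exists. That is, there is exactly one symmetric matrix $P\in\mathbb{R}^{n\times n}$ such that $R+B^\top PB$ is invertible and, with $K:=(R+B^\top PB)^{-1}(S+B^\top PA)$, $$P=Q+A^\top PA-(S^\top+A^\top PB)K,$$ and every eigenvalue $\mu\in\mathbb{C}$ of $A-BK$ satisfies $|\mu|>1$. -/

import Mathlib

open Matrix

noncomputable section

/-- `(A, B)` is controllable: the controllability matrix `[B, AB, …, A ^ (n - 1) B]`
has full row rank. -/
def IsControllable {n m : ℕ} (A : Matrix (Fin n) (Fin n) ℝ) (B : Matrix (Fin n) (Fin m) ℝ) :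
    Prop :=
  (Matrix.of fun (i : Fin n) (p : Fin n × Fin m) => (A ^ (p.1 : ℕ) * B) i p.2).rank = n

/-- The stage cost matrix `H_Λ` rotated by the storage function `λ(x) = xᵀ Λ x`. -/
def rotatedCost {n m : ℕ} (A : Matrix (Fin n) (Fin n) ℝ) (B : Matrix (Fin n) (Fin m) ℝ)
    (Q : Matrix (Fin n) (Fin n) ℝ) (S : Matrix (Fin m) (Fin n) ℝ) (R : Matrix (Fin m) (Fin m) ℝ)
    (L : Matrix (Fin n) (Fin n) ℝ) : Matrix (Fin n ⊕ Fin m) (Fin n ⊕ Fin m) ℝ :=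
  Matrix.fromBlocks (Q + L - Aᵀ * L * A) (Sᵀ - Aᵀ * L * B)
    (S - Bᵀ * L * A) (R - Bᵀ * L * B)

/-- Quadratic strict `(x, u)`-pre-dissipativity: for some storage matrix `L` and some `ε > 0`,
the rotated stage cost is at least `ε (‖x‖² + ‖u‖²)` (Euclidean norms; `x ⬝ᵥ x = ‖x‖²`). -/
def QuadStrictPreDissipative {n m : ℕ} (A : Matrix (Fin n) (Fin n) ℝ)
    (B : Matrix (Fin n) (Fin m) ℝ) (Q : Matrix (Fin n) (Fin n) ℝ) (S : Matrix (Fin m) (Fin n) ℝ)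
    (R : Matrix (Fin m) (Fin m) ℝ) : Prop :=
  ∃ L : Matrix (Fin n) (Fin n) ℝ, ∃ ε : ℝ, 0 < ε ∧
    ∀ (x : Fin n → ℝ) (u : Fin m → ℝ),
      ε * (x ⬝ᵥ x + u ⬝ᵥ u) ≤
        Sum.elim x u ⬝ᵥ (rotatedCost A B Q S R L *ᵥ Sum.elim x u)

/-- The feedback matrix `K = (R + Bᵀ P B)⁻¹ (S + Bᵀ P A)` associated with `P`. -/
def dareGain {n m : ℕ} (A : Matrix (Fin n) (Fin n) ℝ) (B : Matrix (Fin n) (Fin m) ℝ)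
    (S : Matrix (Fin m) (Fin n) ℝ) (R : Matrix (Fin m) (Fin m) ℝ)
    (P : Matrix (Fin n) (Fin n) ℝ) : Matrix (Fin m) (Fin n) ℝ :=
  (R + Bᵀ * P * B)⁻¹ * (S + Bᵀ * P * A)

/-- `P` is a (symmetric) solution of the discrete algebraic Riccati equation; the inverse
occurring in the equation is required to exist. -/
structure IsDARESolution {n m : ℕ} (A : Matrix (Fin n) (Fin n) ℝ) (B : Matrix (Fin n) (Fin m) ℝ)
    (Q : Matrix (Fin n) (Fin n) ℝ) (S : Matrix (Fin m) (Fin n) ℝ) (R : Matrix (Fin m) (Fin m) ℝ)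
    (P : Matrix (Fin n) (Fin n) ℝ) : Prop where
  symm : P.IsSymm
  isUnit : IsUnit (R + Bᵀ * P * B)
  eq : P = Q + Aᵀ * P * A - (Sᵀ + Aᵀ * P * B) * dareGain A B S R P

/-- `P` is an antistabilizing solution of the discrete algebraic Riccati equation: all complex
eigenvalues of the closed-loop matrix `A - B K` lie strictly outside the unit circle. -/
structure IsAntistabilizingDARESolution {n m : ℕ} (A : Matrix (Fin n) (Fin n) ℝ)
    (B : Matrix (Fin n) (Fin m) ℝ) (Q : Matrix (Fin n) (Fin n) ℝ) (S : Matrix (Fin m) (Fin n) ℝ)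
    (R : Matrix (Fin m) (Fin m) ℝ) (P : Matrix (Fin n) (Fin n) ℝ) : Prop where
  solution : IsDARESolution A B Q S R P
  outside : ∀ μ ∈ spectrum ℂ ((A - B * dareGain A B S R P).map (fun t : ℝ => (t : ℂ))), 1 < ‖μ‖

end

/-!
After replacing the storage matrix by its symmetric part `L`, the rotated stage cost is positive
definite. Consider the cheapest way to steer the system *to* a given state from a free initial
state. The value matrices of these problems increase with the horizon and are bounded by
controllability, so they converge to a fixed point `V ≥ 0` of the forward Bellman operator. The
optimality conditions at `V` give the predecessor and the input as linear functions `F`, `U` of the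
state. Because `fromBlocks A B S R` is invertible, which is what the hypothesis on `K` amounts to,
`F` is inverted by a closed-loop matrix `A - B G`, and `(-V, G)` solves the rotated Riccati
equation; `P = -V - L` solves the original one.

The Stein equation `Nᵀ V N = V + W` with `W > 0` forces the spectrum of `N = A - B G` out of the
closed unit disc. For two antistabilizing solutions `P - P' = Nᵀ (P - P') N'`, and a Sylvester
argument gives `P = P'`.
-/

section LoewnerOrder

open scoped ComplexOrder MatrixOrder

variable {𝕜 ι κ : Type*} [RCLike 𝕜]

theorem conjTranspose_mul_mul_le_of_le [Fintype ι] [Finite κ] {X Y : Matrix ι ι 𝕜} (h : X ≤ Y)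
    (Z : Matrix ι κ 𝕜) : Zᴴ * X * Z ≤ Zᴴ * Y * Z := by
  rw [le_iff, ← Matrix.sub_mul, ← Matrix.mul_sub]
  exact PosSemidef.conjTranspose_mul_mul_same h Z

theorem dotProduct_mulVec_le_of_le [Fintype ι] {X Y : Matrix ι ι 𝕜} (h : X ≤ Y) (z : ι → 𝕜) :
    star z ⬝ᵥ (X *ᵥ z) ≤ star z ⬝ᵥ (Y *ᵥ z) := by
  rw [← sub_nonneg, ← dotProduct_sub, ← sub_mulVec]
  exact PosSemidef.dotProduct_mulVec_nonneg h z

theorem star_mulVec_dotProduct_mulVec_mulVec [Fintype ι] [Fintype κ] (V : Matrix κ κ 𝕜)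
    (C : Matrix κ ι 𝕜) (z : ι → 𝕜) :
    star (C *ᵥ z) ⬝ᵥ (V *ᵥ (C *ᵥ z)) = star z ⬝ᵥ ((Cᴴ * V * C) *ᵥ z) := by
  simp only [star_mulVec, dotProduct_mulVec, vecMul_vecMul, Matrix.mul_assoc]

theorem isClosed_setOf_posSemidef [Finite ι] : IsClosed {M : Matrix ι ι 𝕜 | M.PosSemidef} := by
  cases nonempty_fintype ι
  simp only [posSemidef_iff_dotProduct_mulVec, Set.ofPred_and, Set.ofPred_forall]
  refine (isClosed_eq (by fun_prop) continuous_id).inter (isClosed_iInter fun z => ?_)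
  exact isClosed_le continuous_const (by fun_prop)

theorem posSemidef_fromBlocks_zero [Finite ι] [Finite κ] {V : Matrix ι ι 𝕜}
    (hV : V.PosSemidef) : (fromBlocks V 0 0 (0 : Matrix κ κ 𝕜)).PosSemidef := by
  cases nonempty_fintype ι
  classical
  have h := hV.conjTranspose_mul_mul_same (fromCols (1 : Matrix ι ι 𝕜) (0 : Matrix ι κ 𝕜))
  rw [conjTranspose_fromCols_eq_fromRows_conjTranspose, fromRows_mul, fromRows_mul_fromCols] at h
  simpa using h

theorem posDef_add_fromBlocks_zero [Finite ι] [Finite κ] {H : Matrix (ι ⊕ κ) (ι ⊕ κ) 𝕜}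
    {V : Matrix ι ι 𝕜} (hH : H.PosDef) (hV : V.PosSemidef) : (H + fromBlocks V 0 0 0).PosDef :=
  hH.add_posSemidef (posSemidef_fromBlocks_zero hV)

theorem conjTranspose_map_ofReal (M : Matrix ι κ ℝ) :
    (M.map Complex.ofRealHom)ᴴ = Mᵀ.map Complex.ofRealHom := by
  ext i j
  simp

theorem posSemidef_map_ofReal [Finite ι] {M : Matrix ι ι ℝ} (hM : M.PosSemidef) :
    (M.map Complex.ofRealHom).PosSemidef := by
  cases nonempty_fintype ι
  classical
  obtain ⟨X, rfl⟩ := CStarAlgebra.nonneg_iff_eq_star_mul_self.1 hM.nonneg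
  rw [Matrix.map_mul, star_eq_conjTranspose, conjTranspose_eq_transpose_of_trivial,
    ← conjTranspose_map_ofReal]
  exact posSemidef_conjTranspose_mul_self _

theorem posDef_map_ofReal [Finite ι] {M : Matrix ι ι ℝ} (hM : M.PosDef) :
    (M.map Complex.ofRealHom).PosDef := by
  cases nonempty_fintype ι
  classical
  rw [(posSemidef_map_ofReal hM.posSemidef).posDef_iff_isUnit]
  exact hM.isUnit.map Complex.ofRealHom.mapMatrix

theorem posDef_half_smul_add_transpose [Fintype ι] {M : Matrix ι ι ℝ}
    (hM : ∀ z ≠ 0, 0 < z ⬝ᵥ (M *ᵥ z)) : ((1 / 2 : ℝ) • (M + Mᵀ)).PosDef := by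
  refine PosDef.of_dotProduct_mulVec_pos ?_ fun z hz => ?_
  · simp [IsHermitian, add_comm]
  · have hT : z ⬝ᵥ (Mᵀ *ᵥ z) = z ⬝ᵥ (M *ᵥ z) := by
      rw [mulVec_transpose, dotProduct_comm, dotProduct_mulVec]
    simp only [star_trivial, smul_mulVec, add_mulVec, dotProduct_smul, dotProduct_add, hT,
      smul_eq_mul]
    linarith [hM z hz]

theorem apply_eq_polarization [Fintype ι] [DecidableEq ι] {M : Matrix ι ι ℝ}
    (hM : M.IsHermitian) (i j : ι) :
    M i j = ((Pi.single i 1 + Pi.single j 1) ⬝ᵥ (M *ᵥ (Pi.single i 1 + Pi.single j 1))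
      - Pi.single i 1 ⬝ᵥ (M *ᵥ Pi.single i 1) - Pi.single j 1 ⬝ᵥ (M *ᵥ Pi.single j 1)) / 2 := by
  have hij : M j i = M i j := by simpa using hM.apply i j
  simp [mulVec_add, add_dotProduct, hij]
  ring

theorem exists_tendsto_of_monotone_of_bddAbove {α : Type*} [Preorder α] [Fintype ι]
    {u : α → Matrix ι ι ℝ} (hu : Monotone u) (hH : ∀ a, (u a).IsHermitian)
    (hb : ∀ y, BddAbove (Set.range fun a => y ⬝ᵥ (u a *ᵥ y))) :
    ∃ V, Filter.Tendsto u Filter.atTop (nhds V) := by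
  classical
  have hq : ∀ y, ∃ q, Filter.Tendsto (fun a => y ⬝ᵥ (u a *ᵥ y)) Filter.atTop (nhds q) := fun y =>
    ⟨_, tendsto_atTop_ciSup (fun a b h => by simpa using dotProduct_mulVec_le_of_le (hu h) y)
      (hb y)⟩
  choose q hq using hq
  refine ⟨Matrix.of fun i j => (q (Pi.single i 1 + Pi.single j 1) - q (Pi.single i 1)
    - q (Pi.single j 1)) / 2, tendsto_pi_nhds.2 fun i => tendsto_pi_nhds.2 fun j => ?_⟩
  simp only [apply_eq_polarization (hH _) i j]
  exact (((hq _).sub (hq _)).sub (hq _)).div_const 2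

end LoewnerOrder

section ConstrainedMinimum

open scoped ComplexOrder MatrixOrder

variable {𝕜 ι κ : Type*} [RCLike 𝕜] [Fintype ι] [Fintype κ] [DecidableEq ι] [DecidableEq κ]

/-- The matrix of the value function `y ↦ min {zᴴ G z | C z = y}` of a least-norm problem with
positive definite `G` and surjective `C`. -/
noncomputable def minCost (G : Matrix ι ι 𝕜) (C : Matrix κ ι 𝕜) : Matrix κ κ 𝕜 :=
  (C * G⁻¹ * Cᴴ)⁻¹

/-- The matrix sending `y` to the minimizer of `zᴴ G z` subject to `C z = y`. -/
noncomputable def minArg (G : Matrix ι ι 𝕜) (C : Matrix κ ι 𝕜) : Matrix ι κ 𝕜 :=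
  G⁻¹ * Cᴴ * minCost G C

variable {G G' : Matrix ι ι 𝕜} {C : Matrix κ ι 𝕜}

theorem minCost_posDef (hG : G.PosDef) (hC : Function.Injective C.vecMul) : (minCost G C).PosDef :=
  (hG.inv.mul_mul_conjTranspose_same hC).inv

theorem mul_minArg_eq_one (hG : G.PosDef) (hC : Function.Injective C.vecMul) :
    C * minArg G C = 1 := by
  have hdet := (isUnit_iff_isUnit_det _).1 (hG.inv.mul_mul_conjTranspose_same hC).isUnit
  rw [minArg, ← Matrix.mul_assoc, ← Matrix.mul_assoc, minCost, mul_nonsing_inv _ hdet]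

theorem mul_minArg (hG : G.PosDef) : G * minArg G C = Cᴴ * minCost G C := by
  rw [minArg, Matrix.mul_assoc, mul_nonsing_inv_cancel_left _ _
    ((isUnit_iff_isUnit_det _).1 hG.isUnit)]

theorem conjTranspose_minArg_mul (hG : G.PosDef) (hC : Function.Injective C.vecMul) :
    (minArg G C)ᴴ * G = minCost G C * C := by
  simpa [hG.isHermitian.eq, (minCost_posDef hG hC).isHermitian.eq]
    using congrArg conjTranspose (mul_minArg (C := C) hG)

theorem conjTranspose_minArg_mul_mul_minArg (hG : G.PosDef) (hC : Function.Injective C.vecMul) :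
    (minArg G C)ᴴ * G * minArg G C = minCost G C := by
  rw [conjTranspose_minArg_mul hG hC, Matrix.mul_assoc, mul_minArg_eq_one hG hC, Matrix.mul_one]

theorem conjTranspose_mul_minCost_mul_le (hG : G.PosDef) (hC : Function.Injective C.vecMul) :
    Cᴴ * minCost G C * C ≤ G := by
  have hsq : G - Cᴴ * minCost G C * C = (1 - minArg G C * C)ᴴ * G * (1 - minArg G C * C) :=
    calc G - Cᴴ * minCost G C * C
        = G - G * minArg G C * C - Cᴴ * ((minArg G C)ᴴ * G)
          + Cᴴ * ((minArg G C)ᴴ * G * minArg G C) * C := by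
          rw [mul_minArg hG, conjTranspose_minArg_mul_mul_minArg hG hC,
            conjTranspose_minArg_mul hG hC, ← Matrix.mul_assoc]
          abel
      _ = _ := by
          simp only [conjTranspose_sub, conjTranspose_one, conjTranspose_mul, Matrix.sub_mul,
            Matrix.mul_sub, Matrix.one_mul, Matrix.mul_one, Matrix.mul_assoc]
          abel
  rw [le_iff, hsq]
  exact hG.posSemidef.conjTranspose_mul_mul_same _

theorem minCost_mono (hG : G.PosDef) (hG' : G'.PosDef) (hC : Function.Injective C.vecMul)
    (h : G ≤ G') : minCost G C ≤ minCost G' C := by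
  have hCZ := mul_minArg_eq_one hG' hC
  calc minCost G C
      = (minArg G' C)ᴴ * (Cᴴ * minCost G C * C) * minArg G' C := by
        rw [← Matrix.mul_assoc, ← Matrix.mul_assoc, ← conjTranspose_mul, Matrix.mul_assoc _ C, hCZ,
          conjTranspose_one, Matrix.one_mul, Matrix.mul_one]
    _ ≤ (minArg G' C)ᴴ * G' * minArg G' C :=
        conjTranspose_mul_mul_le_of_le ((conjTranspose_mul_minCost_mul_le hG hC).trans h) _
    _ = minCost G' C := conjTranspose_minArg_mul_mul_minArg hG' hC

theorem continuousAt_inv_of_isUnit {M : Matrix ι ι 𝕜} (hM : IsUnit M) :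
    ContinuousAt Inv.inv M := by
  refine continuousAt_matrix_inv M ?_
  rw [Ring.inverse_eq_inv']
  exact continuousAt_inv₀ ((isUnit_iff_isUnit_det _).1 hM).ne_zero

theorem continuousAt_minCost (hG : G.PosDef) (hC : Function.Injective C.vecMul) :
    ContinuousAt (fun X => minCost X C) G := by
  have hmul : Continuous fun X : Matrix ι ι 𝕜 => C * X * Cᴴ := by fun_prop
  exact (continuousAt_inv_of_isUnit (hG.inv.mul_mul_conjTranspose_same hC).isUnit).comp
    (f := fun X => C * X⁻¹ * Cᴴ) (hmul.continuousAt.comp (continuousAt_inv_of_isUnit hG.isUnit))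

end ConstrainedMinimum

section Antistable

open Polynomial

theorem aeval_mul_eq_mul_aeval {K ι κ : Type*} [CommRing K] [Fintype ι] [Fintype κ]
    [DecidableEq ι] [DecidableEq κ] {N : Matrix κ κ K} {M : Matrix ι ι K} {X : Matrix κ ι K}
    (h : N * X = X * M) (p : K[X]) : aeval N p * X = X * aeval M p := by
  induction p using Polynomial.induction_on with
  | C a => simp [Algebra.algebraMap_eq_smul_one]
  | add p q hp hq => rw [map_add, map_add, Matrix.add_mul, Matrix.mul_add, hp, hq]
  | monomial k a ih =>
    rw [pow_succ, ← mul_assoc, map_mul, map_mul (aeval M), aeval_X, aeval_X, Matrix.mul_assoc, h,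
      ← Matrix.mul_assoc, ih, Matrix.mul_assoc]

theorem eq_zero_of_mul_eq_mul_of_disjoint_spectrum {K ι κ : Type*} [Field K] [IsAlgClosed K]
    [Fintype ι] [Fintype κ] [DecidableEq ι] [DecidableEq κ] {N : Matrix κ κ K} {M : Matrix ι ι K}
    {X : Matrix κ ι K} (h : N * X = X * M) (hNM : Disjoint (spectrum K N) (spectrum K M)) :
    X = 0 := by
  -- `χ_M(N) X = X χ_M(M) = 0` by Cayley–Hamilton, and no root of `χ_M` is an eigenvalue of `N`.
  have hunit : IsUnit (aeval N M.charpoly) := by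
    by_contra hc
    rw [(IsAlgClosed.splits M.charpoly).eq_prod_roots_of_monic M.charpoly_monic] at hc
    obtain ⟨k, hkN, hk⟩ := spectrum.exists_mem_of_not_isUnit_aeval_prod hc
    exact Set.disjoint_left.1 hNM hkN (mem_spectrum_iff_isRoot_charpoly.2 hk)
  have hzero : aeval N M.charpoly * X = 0 := by
    rw [aeval_mul_eq_mul_aeval h, aeval_self_charpoly, Matrix.mul_zero]
  rw [← nonsing_inv_mul_cancel_left _ X ((isUnit_iff_isUnit_det _).1 hunit), hzero,
    Matrix.mul_zero]

variable {ι κ : Type*} [Fintype ι] [Fintype κ] [DecidableEq ι] [DecidableEq κ]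

/-- Antistability of a discrete-time linear system `x⁺ = N x`: every eigenvalue lies strictly
outside the closed unit disc. -/
def IsAntistable (N : Matrix κ κ ℂ) : Prop :=
  ∀ μ ∈ spectrum ℂ N, 1 < ‖μ‖

namespace IsAntistable

theorem isUnit {N : Matrix κ κ ℂ} (hN : IsAntistable N) : IsUnit N := by
  by_contra hc
  have h0 := hN 0 ((spectrum.zero_mem_iff ℂ).2 hc)
  norm_num at h0

theorem conjTranspose {N : Matrix κ κ ℂ} (hN : IsAntistable N) : IsAntistable Nᴴ := by
  intro μ hμ
  rw [← star_eq_conjTranspose, spectrum.map_star] at hμ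
  simpa using hN _ hμ

theorem eq_zero_of_eq_mul_mul {N : Matrix κ κ ℂ} {M : Matrix ι ι ℂ} {X : Matrix κ ι ℂ}
    (hN : IsAntistable N) (hM : IsAntistable M) (h : X = N * X * M) : X = 0 := by
  obtain ⟨U, rfl⟩ := hN.isUnit
  have hinv : (↑U⁻¹ : Matrix κ κ ℂ) * X = X * M := by
    conv_lhs => rw [h]
    rw [Matrix.mul_assoc (U : Matrix κ κ ℂ), ← Matrix.mul_assoc, Units.inv_mul, Matrix.one_mul]
  refine eq_zero_of_mul_eq_mul_of_disjoint_spectrum hinv (Set.disjoint_left.2 fun k hkU hkM => ?_)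
  have hk1 : 1 < ‖k‖ := hM k hkM
  have hk0 : k ≠ 0 := norm_pos_iff.1 (zero_lt_one.trans hk1)
  have hkinv : 1 < ‖k⁻¹‖ := hN k⁻¹ (by
    simpa using (spectrum.inv_mem_iff (R := ℂ) (r := Units.mk0 k hk0) (a := U⁻¹)).1 hkU)
  rw [norm_inv] at hkinv
  exact (inv_lt_one_of_one_lt₀ hk1).not_gt hkinv

open scoped ComplexOrder in
/-- Pair the equation with an eigenvector `z` for `μ`: `(|μ|² - 1) zᴴ V z = zᴴ W z > 0`. -/
theorem of_stein {N V W : Matrix κ κ ℂ} (hV : V.PosSemidef) (hW : W.PosDef)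
    (h : Nᴴ * V * N = V + W) : IsAntistable N := by
  intro μ hμ
  rw [← spectrum_toLin', ← Module.End.hasEigenvalue_iff_mem_spectrum] at hμ
  obtain ⟨z, hz⟩ := hμ.exists_hasEigenvector
  have hNz : N *ᵥ z = μ • z := by simpa using hz.apply_eq_smul
  have hpair : ((‖μ‖ ^ 2 : ℝ) : ℂ) * (star z ⬝ᵥ (V *ᵥ z))
      = star z ⬝ᵥ (V *ᵥ z) + star z ⬝ᵥ (W *ᵥ z) := by
    rw [← dotProduct_add, ← add_mulVec, ← h, ← star_mulVec_dotProduct_mulVec_mulVec, hNz]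
    simp only [star_smul, mulVec_smul, smul_dotProduct, dotProduct_smul, smul_eq_mul, ← mul_assoc]
    rw [Complex.star_def, Complex.mul_conj', Complex.ofReal_pow]
  have hre := congrArg Complex.re hpair
  rw [Complex.re_ofReal_mul, Complex.add_re] at hre
  have hVz := hV.re_dotProduct_nonneg z
  have hWz := hW.re_dotProduct_pos hz.2
  simp only [RCLike.re_to_complex] at hVz hWz
  rw [← one_lt_sq_iff₀ (norm_nonneg μ)]
  by_contra! hle
  linarith [mul_le_mul_of_nonneg_right hle hVz]

end IsAntistable

end Antistable

section ValueIteration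

open scoped ComplexOrder MatrixOrder

variable {𝕜 ν μ : Type*} [RCLike 𝕜] [Fintype ν] [Fintype μ] [DecidableEq ν] [DecidableEq μ]

/-- The forward Bellman operator of `x⁺ = A x + B u` with stage cost `H`, for steering to a
prescribed terminal state: if arriving at `x` costs `xᴴ V x`, then arriving at `y` one step later
costs `min {zᴴ H z + xᴴ V x | z = (x, u), A x + B u = y}`. -/
noncomputable def bellman (A : Matrix ν ν 𝕜) (B : Matrix ν μ 𝕜) (H : Matrix (ν ⊕ μ) (ν ⊕ μ) 𝕜)
    (V : Matrix ν ν 𝕜) : Matrix ν ν 𝕜 :=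
  minCost (H + fromBlocks V 0 0 0) (fromCols A B)

variable {A : Matrix ν ν 𝕜} {B : Matrix ν μ 𝕜} {H : Matrix (ν ⊕ μ) (ν ⊕ μ) 𝕜}
  {V V' : Matrix ν ν 𝕜}

theorem bellman_posDef (hH : H.PosDef) (hAB : Function.Injective (fromCols A B).vecMul)
    (hV : V.PosSemidef) : (bellman A B H V).PosDef :=
  minCost_posDef (posDef_add_fromBlocks_zero hH hV) hAB

theorem bellman_mono (hH : H.PosDef) (hAB : Function.Injective (fromCols A B).vecMul)
    (hV : V.PosSemidef) (h : V ≤ V') : bellman A B H V ≤ bellman A B H V' := by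
  have hV' : V'.PosSemidef := (hV.nonneg.trans h).posSemidef
  refine minCost_mono (posDef_add_fromBlocks_zero hH hV) (posDef_add_fromBlocks_zero hH hV') hAB ?_
  have hsub : fromBlocks V' 0 0 0 - fromBlocks V 0 0 (0 : Matrix μ μ 𝕜)
      = fromBlocks (V' - V) 0 0 0 := by
    ext (i | i) (j | j) <;> simp
  rw [le_iff, add_sub_add_left_eq_sub, hsub]
  exact posSemidef_fromBlocks_zero h

theorem dotProduct_bellman_mulVec_le (hH : H.PosDef)
    (hAB : Function.Injective (fromCols A B).vecMul) (hV : V.PosSemidef) (x : ν → 𝕜) (u : μ → 𝕜) :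
    star (A *ᵥ x + B *ᵥ u) ⬝ᵥ (bellman A B H V *ᵥ (A *ᵥ x + B *ᵥ u))
      ≤ star (Sum.elim x u) ⬝ᵥ (H *ᵥ Sum.elim x u) + star x ⬝ᵥ (V *ᵥ x) := by
  have hle := dotProduct_mulVec_le_of_le
    (conjTranspose_mul_minCost_mul_le (posDef_add_fromBlocks_zero hH hV) hAB) (Sum.elim x u)
  have hstar : star (Sum.elim x u) = Sum.elim (star x) (star u) := by
    ext (i | i) <;> rfl
  rw [← star_mulVec_dotProduct_mulVec_mulVec, fromCols_mulVec_sumElim] at hle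
  simpa only [bellman, add_mulVec, dotProduct_add, fromBlocks_mulVec, Sum.elim_comp_inl,
    Sum.elim_comp_inr, zero_mulVec, add_zero, hstar, sumElim_dotProduct_sumElim,
    dotProduct_zero] using hle

theorem continuousAt_bellman (hH : H.PosDef) (hAB : Function.Injective (fromCols A B).vecMul)
    (hV : V.PosSemidef) : ContinuousAt (bellman A B H) V := by
  have hcost : Continuous fun X : Matrix ν ν 𝕜 => H + fromBlocks X 0 0 (0 : Matrix μ μ 𝕜) := by
    fun_prop
  exact (continuousAt_minCost (posDef_add_fromBlocks_zero hH hV) hAB).comp hcost.continuousAt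
    (f := fun X => H + fromBlocks X 0 0 0)

/-- The matrix of the least cost of arriving at a given state after `k` steps from a free initial
state: the `k`-th Bellman iterate of zero. -/
noncomputable def valueIter (A : Matrix ν ν 𝕜) (B : Matrix ν μ 𝕜) (H : Matrix (ν ⊕ μ) (ν ⊕ μ) 𝕜) :
    ℕ → Matrix ν ν 𝕜
  | 0 => 0
  | k + 1 => bellman A B H (valueIter A B H k)

theorem valueIter_posSemidef (hH : H.PosDef) (hAB : Function.Injective (fromCols A B).vecMul) :
    ∀ k, (valueIter A B H k).PosSemidef
  | 0 => PosSemidef.zero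
  | k + 1 => (bellman_posDef hH hAB (valueIter_posSemidef hH hAB k)).posSemidef

theorem monotone_valueIter (hH : H.PosDef) (hAB : Function.Injective (fromCols A B).vecMul) :
    Monotone (valueIter A B H) := by
  have hpos := valueIter_posSemidef hH hAB
  refine monotone_nat_of_le_succ fun k => ?_
  induction k with
  | zero => exact (hpos 1).nonneg
  | succ k ih => exact bellman_mono hH hAB (hpos k) ih

theorem bddAbove_valueIter_step (hH : H.PosDef) (hAB : Function.Injective (fromCols A B).vecMul)
    {x : ν → 𝕜} (hx : BddAbove (Set.range fun k => star x ⬝ᵥ (valueIter A B H k *ᵥ x)))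
    (u : μ → 𝕜) :
    BddAbove (Set.range fun k =>
      star (A *ᵥ x + B *ᵥ u) ⬝ᵥ (valueIter A B H k *ᵥ (A *ᵥ x + B *ᵥ u))) := by
  obtain ⟨c, hc⟩ := hx
  refine ⟨star (Sum.elim x u) ⬝ᵥ (H *ᵥ Sum.elim x u) + c, ?_⟩
  rintro _ ⟨k, rfl⟩
  calc star (A *ᵥ x + B *ᵥ u) ⬝ᵥ (valueIter A B H k *ᵥ (A *ᵥ x + B *ᵥ u))
      ≤ star (A *ᵥ x + B *ᵥ u) ⬝ᵥ (valueIter A B H (k + 1) *ᵥ (A *ᵥ x + B *ᵥ u)) :=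
        dotProduct_mulVec_le_of_le (monotone_valueIter hH hAB k.le_succ) _
    _ ≤ star (Sum.elim x u) ⬝ᵥ (H *ᵥ Sum.elim x u) + star x ⬝ᵥ (valueIter A B H k *ᵥ x) :=
        dotProduct_bellman_mulVec_le hH hAB (valueIter_posSemidef hH hAB k) x u
    _ ≤ star (Sum.elim x u) ⬝ᵥ (H *ᵥ Sum.elim x u) + c := by gcongr; exact hc ⟨k, rfl⟩

end ValueIteration

section Controllability

variable {n m : ℕ} {A : Matrix (Fin n) (Fin n) ℝ} {B : Matrix (Fin n) (Fin m) ℝ}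

namespace IsControllable

theorem exists_sum_eq (h : IsControllable A B) (y : Fin n → ℝ) :
    ∃ u : ℕ → Fin m → ℝ, ∑ p ∈ Finset.range n, (A ^ p * B) *ᵥ u p = y := by
  set M := Matrix.of fun (i : Fin n) (p : Fin n × Fin m) => (A ^ (p.1 : ℕ) * B) i p.2
  have hrange : LinearMap.range M.mulVecLin = ⊤ :=
    Submodule.eq_top_of_finrank_eq (h.trans (Module.finrank_fin_fun ℝ).symm)
  obtain ⟨w, hw⟩ := LinearMap.range_eq_top.1 hrange y
  refine ⟨fun p j => if hp : p < n then w (⟨p, hp⟩, j) else 0, ?_⟩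
  rw [← hw, Finset.sum_range]
  ext i
  simp [M, mulVec, dotProduct, Fintype.sum_prod_type, Finset.sum_apply]

theorem induction (h : IsControllable A B) {p : (Fin n → ℝ) → Prop} (zero : p 0)
    (step : ∀ x u, p x → p (A *ᵥ x + B *ᵥ u)) (y : Fin n → ℝ) : p y := by
  have hreach : ∀ (N : ℕ) (u : ℕ → Fin m → ℝ),
      p (∑ k ∈ Finset.range N, (A ^ k * B) *ᵥ u k) := by
    intro N
    induction N with
    | zero => simpa using zero
    | succ N ih =>
      intro u
      have hsum := step _ (u 0) (ih fun k => u (k + 1))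
      simpa only [Finset.sum_range_succ', mulVec_sum, mulVec_mulVec, ← Matrix.mul_assoc,
        ← pow_succ', pow_zero, Matrix.one_mul] using hsum
  obtain ⟨u, rfl⟩ := h.exists_sum_eq y
  exact hreach n u

theorem injective_vecMul_fromCols (h : IsControllable A B) :
    Function.Injective (fromCols A B).vecMul := by
  refine (injective_iff_map_eq_zero (vecMulLinear (fromCols A B))).2 fun w hw => ?_
  rw [vecMulLinear_apply, vecMul_fromCols] at hw
  have hA : w ᵥ* A = 0 := funext fun i => congrFun hw (Sum.inl i)
  have hB : w ᵥ* B = 0 := funext fun i => congrFun hw (Sum.inr i)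
  refine dotProduct_eq_zero w fun y => ?_
  refine h.induction (p := fun y => w ⬝ᵥ y = 0) (dotProduct_zero w) (fun x u _ => ?_) y
  rw [dotProduct_add, dotProduct_mulVec, dotProduct_mulVec, hA, hB, zero_dotProduct,
    zero_dotProduct, add_zero]

theorem exists_posSemidef_eq_bellman (h : IsControllable A B)
    {H : Matrix (Fin n ⊕ Fin m) (Fin n ⊕ Fin m) ℝ} (hH : H.PosDef) :
    ∃ V : Matrix (Fin n) (Fin n) ℝ, V.PosSemidef ∧ V = bellman A B H V := by
  have hAB := h.injective_vecMul_fromCols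
  have hpos := valueIter_posSemidef hH hAB
  have hbdd : ∀ y, BddAbove (Set.range fun k => y ⬝ᵥ (valueIter A B H k *ᵥ y)) :=
    h.induction (by simp)
      fun x u hx => by simpa using bddAbove_valueIter_step hH hAB (by simpa using hx) u
  obtain ⟨V, hV⟩ := exists_tendsto_of_monotone_of_bddAbove (monotone_valueIter hH hAB)
    (fun k => (hpos k).isHermitian) hbdd
  have hVpos : V.PosSemidef :=
    isClosed_setOf_posSemidef.mem_of_tendsto hV (Filter.Eventually.of_forall hpos)
  exact ⟨V, hVpos, tendsto_nhds_unique (hV.comp (Filter.tendsto_add_atTop_nat 1))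
    ((continuousAt_bellman hH hAB hVpos).tendsto.comp hV)⟩

end IsControllable

end Controllability

section Riccati

variable {𝕜 ν μ : Type*} [CommRing 𝕜] [Fintype ν] [Fintype μ]

/-- The Riccati equation for `P` with the gain `K` as an additional unknown in place of the inverse
`(R + Bᵀ P B)⁻¹`: stationarity in the input and the cost recursion, both written in terms of the
closed-loop matrix `A - B K`. -/
structure IsClosedLoopRiccati (A : Matrix ν ν 𝕜) (B : Matrix ν μ 𝕜) (Q : Matrix ν ν 𝕜)
    (S : Matrix μ ν 𝕜) (R : Matrix μ μ 𝕜) (P : Matrix ν ν 𝕜) (K : Matrix μ ν 𝕜) : Prop where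
  stationary : R * K = S + Bᵀ * P * (A - B * K)
  cost : P = Q - Sᵀ * K + Aᵀ * P * (A - B * K)

/-- The matrix of `x ↦ (x, -K x)`, which sends a state to the pair of that state and its input under
the feedback `u = -K x`. -/
def feedbackGraph [DecidableEq ν] (K : Matrix μ ν 𝕜) : Matrix (ν ⊕ μ) ν 𝕜 :=
  fromRows 1 (-K)

variable {A : Matrix ν ν 𝕜} {B : Matrix ν μ 𝕜} {Q : Matrix ν ν 𝕜} {S : Matrix μ ν 𝕜}
  {R : Matrix μ μ 𝕜} {P : Matrix ν ν 𝕜} {K : Matrix μ ν 𝕜}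

theorem isUnit_fromBlocks_rotate [DecidableEq ν] [DecidableEq μ] (L : Matrix ν ν 𝕜)
    (hM : IsUnit (fromBlocks A B S R)) :
    IsUnit (fromBlocks A B (S - Bᵀ * L * A) (R - Bᵀ * L * B)) := by
  have hfac : fromBlocks A B (S - Bᵀ * L * A) (R - Bᵀ * L * B)
      = fromBlocks 1 0 (-(Bᵀ * L)) 1 * fromBlocks A B S R := by
    simp [fromBlocks_multiply, neg_add_eq_sub]
  rw [hfac]
  exact (isUnit_fromBlocks_zero₁₂.2 ⟨isUnit_one, isUnit_one⟩).mul hM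

theorem isUnit_fromBlocks_of_feedback [DecidableEq ν] [DecidableEq μ] (hAK : IsUnit (A - B * K))
    (hD : IsUnit (R - (S - R * K) * (A - B * K)⁻¹ * B)) : IsUnit (fromBlocks A B S R) := by
  have hfac : fromBlocks A B S R * fromBlocks 1 0 (-K) 1
      = fromBlocks (A - B * K) B (S - R * K) R := by
    simp [fromBlocks_multiply, sub_eq_add_neg]
  refine isUnit_of_mul_isUnit_left (y := fromBlocks 1 0 (-K) 1) ?_
  let := hAK.invertible
  rwa [hfac, isUnit_fromBlocks_iff_of_invertible₁₁, invOf_eq_nonsing_inv]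

theorem exists_isClosedLoopRiccati_neg [DecidableEq ν] [DecidableEq μ] (hR : R.IsSymm)
    (hM : IsUnit (fromBlocks A B S R)) {V F : Matrix ν ν 𝕜} {U : Matrix μ ν 𝕜}
    (hdyn : A * F + B * U = 1) (hcost : (Q + V) * F + Sᵀ * U = Aᵀ * V)
    (hstat : S * F + R * U = Bᵀ * V) : ∃ K, IsClosedLoopRiccati A B Q S R (-V) K := by
  set T := (fromBlocks A B S R)ᵀ with hT
  have hTdet : IsUnit T.det := by rwa [hT, det_transpose, ← isUnit_iff_isUnit_det]
  have hTmul : ∀ (Y : Matrix ν ν 𝕜) (X : Matrix μ ν 𝕜),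
      T * fromRows Y X = fromRows (Aᵀ * Y + Sᵀ * X) (Bᵀ * Y + R * X) := fun Y X => by
    rw [hT, fromBlocks_transpose, hR.eq, fromBlocks_mul_fromRows]
  obtain ⟨Y, K, hYK⟩ : ∃ Y K, T⁻¹ * fromRows (Q + V) S = fromRows Y K :=
    ⟨_, _, (fromRows_toRows _).symm⟩
  obtain ⟨hY, hK⟩ : Aᵀ * Y + Sᵀ * K = Q + V ∧ Bᵀ * Y + R * K = S := by
    apply fromRows_inj
    rw [← hTmul, ← hYK, mul_nonsing_inv_cancel_left _ _ hTdet]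
  have hVU : fromRows V (-U) = fromRows (Y * F) (K * F) :=
    calc fromRows V (-U) = T⁻¹ * (T * fromRows V (-U)) :=
          (nonsing_inv_mul_cancel_left _ _ hTdet).symm
      _ = T⁻¹ * (fromRows (Q + V) S * F) := by
          rw [hTmul, fromRows_mul, ← hcost, ← hstat]
          simp
      _ = fromRows (Y * F) (K * F) := by rw [← Matrix.mul_assoc, hYK, fromRows_mul]
  obtain ⟨hV, hU⟩ := fromRows_inj hVU
  have hleft : (A - B * K) * F = 1 := by
    rw [Matrix.sub_mul, Matrix.mul_assoc, ← hU, Matrix.mul_neg, sub_neg_eq_add, hdyn]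
  have hYV : V * (A - B * K) = Y := by
    rw [hV, Matrix.mul_assoc, mul_eq_one_comm.1 hleft, Matrix.mul_one]
  refine ⟨K, ?_, ?_⟩
  · rw [Matrix.mul_neg, Matrix.neg_mul, Matrix.mul_assoc, hYV, ← hK]
    abel
  · rw [Matrix.mul_neg, Matrix.neg_mul, Matrix.mul_assoc, hYV, eq_sub_of_add_eq hY.symm]
    abel

namespace IsClosedLoopRiccati

theorem transpose_sub_mul_mul_sub [DecidableEq ν] (h : IsClosedLoopRiccati A B Q S R P K)
    (K' : Matrix μ ν 𝕜) : (A - B * K')ᵀ * P * (A - B * K)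
      = P - (feedbackGraph K')ᵀ * fromBlocks Q Sᵀ S R * feedbackGraph K := by
  have hA : Aᵀ * P * (A - B * K) = P - Q + Sᵀ * K := by
    rw [sub_add]
    exact eq_sub_of_add_eq' h.cost.symm
  have hB : Bᵀ * P * (A - B * K) = R * K - S := eq_sub_of_add_eq' h.stationary.symm
  calc (A - B * K')ᵀ * P * (A - B * K)
      = Aᵀ * P * (A - B * K) - K'ᵀ * (Bᵀ * P * (A - B * K)) := by
        simp only [transpose_sub, transpose_mul, Matrix.sub_mul, Matrix.mul_assoc]
    _ = P - (Q - Sᵀ * K - K'ᵀ * (S - R * K)) := by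
        rw [hA, hB, Matrix.mul_sub, Matrix.mul_sub]
        abel
    _ = _ := by
        rw [feedbackGraph, feedbackGraph, transpose_fromRows, fromCols_mul_fromBlocks,
          fromCols_mul_fromRows]
        simp only [transpose_one, transpose_neg, Matrix.one_mul, Matrix.mul_one, Matrix.neg_mul,
          Matrix.mul_neg, Matrix.add_mul, Matrix.mul_sub, Matrix.mul_assoc]
        abel

theorem of_rotated {L : Matrix ν ν 𝕜} (hL : L.IsSymm)
    (h : IsClosedLoopRiccati A B (Q + L - Aᵀ * L * A) (S - Bᵀ * L * A) (R - Bᵀ * L * B) P K) :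
    IsClosedLoopRiccati A B Q S R (P - L) K where
  stationary := by
    have hs := h.stationary
    simp only [Matrix.sub_mul, Matrix.mul_sub, Matrix.mul_assoc] at hs ⊢
    linear_combination (norm := abel) hs
  cost := by
    have hc := h.cost
    simp only [transpose_sub, transpose_mul, transpose_transpose, hL.eq, Matrix.sub_mul,
      Matrix.mul_sub, Matrix.mul_assoc] at hc ⊢
    linear_combination (norm := abel) hc

theorem isUnit [DecidableEq ν] [DecidableEq μ] (h : IsClosedLoopRiccati A B Q S R P K)
    (hM : IsUnit (fromBlocks A B S R)) : IsUnit (R + Bᵀ * P * B) := by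
  have hshear : ∀ X : Matrix μ ν 𝕜, IsUnit (fromBlocks 1 0 X 1) := fun X =>
    isUnit_fromBlocks_zero₁₂.2 ⟨isUnit_one, isUnit_one⟩
  have hfac : fromBlocks 1 0 (Bᵀ * P) 1 * fromBlocks A B S R * fromBlocks 1 0 (-K) 1
      = fromBlocks (A - B * K) B 0 (R + Bᵀ * P * B) := by
    have hs : S + Bᵀ * P * A - (R + Bᵀ * P * B) * K = 0 := by
      rw [Matrix.add_mul, h.stationary]
      simp only [Matrix.mul_sub, Matrix.mul_assoc]
      abel
    simp [fromBlocks_multiply, ← sub_eq_add_neg, hs, add_comm]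
  have hprod := ((hshear (Bᵀ * P)).mul hM).mul (hshear (-K))
  rw [hfac] at hprod
  exact (isUnit_fromBlocks_zero₂₁.1 hprod).2

theorem sub_eq_transpose_mul_sub_mul {P' : Matrix ν ν 𝕜} {K' : Matrix μ ν 𝕜}
    (h : IsClosedLoopRiccati A B Q S R P K) (h' : IsClosedLoopRiccati A B Q S R P' K')
    (hQ : Q.IsSymm) (hR : R.IsSymm) (hP : P.IsSymm) :
    P - P' = (A - B * K)ᵀ * (P - P') * (A - B * K') := by
  classical
  have hH : (fromBlocks Q Sᵀ S R).IsSymm := hQ.fromBlocks (transpose_transpose S) hR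
  have hPK : (A - B * K)ᵀ * P * (A - B * K')
      = P - (feedbackGraph K)ᵀ * fromBlocks Q Sᵀ S R * feedbackGraph K' := by
    simpa only [transpose_mul, transpose_sub, transpose_transpose, hP.eq, hH.eq, Matrix.mul_assoc]
      using congrArg transpose (h.transpose_sub_mul_mul_sub K')
  rw [Matrix.mul_sub _ P, Matrix.sub_mul, hPK, h'.transpose_sub_mul_mul_sub,
    sub_sub_sub_cancel_right]

end IsClosedLoopRiccati

end Riccati

section RealRiccati

open scoped ComplexOrder

variable {ν μ : Type*} [Fintype ν] [Fintype μ] [DecidableEq ν]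
  {A : Matrix ν ν ℝ} {B : Matrix ν μ ℝ} {Q : Matrix ν ν ℝ} {S : Matrix μ ν ℝ} {R : Matrix μ μ ℝ}
  {P P' : Matrix ν ν ℝ} {K K' : Matrix μ ν ℝ}

theorem exists_optimality_of_eq_bellman [DecidableEq μ] {V : Matrix ν ν ℝ}
    (hH : (fromBlocks Q Sᵀ S R).PosDef) (hAB : Function.Injective (fromCols A B).vecMul)
    (hV : V.PosSemidef) (h : V = bellman A B (fromBlocks Q Sᵀ S R) V) :
    ∃ (F : Matrix ν ν ℝ) (U : Matrix μ ν ℝ), A * F + B * U = 1 ∧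
      (Q + V) * F + Sᵀ * U = Aᵀ * V ∧ S * F + R * U = Bᵀ * V := by
  have hG := posDef_add_fromBlocks_zero hH hV
  obtain ⟨F, U, hFU⟩ : ∃ F U,
      minArg (fromBlocks Q Sᵀ S R + fromBlocks V 0 0 0) (fromCols A B) = fromRows F U :=
    ⟨_, _, (fromRows_toRows _).symm⟩
  have hdyn := mul_minArg_eq_one hG hAB
  have hopt := mul_minArg (C := fromCols A B) hG
  rw [hFU, fromCols_mul_fromRows] at hdyn
  rw [← bellman, ← h, hFU, fromBlocks_add, fromBlocks_mul_fromRows,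
    conjTranspose_eq_transpose_of_trivial, transpose_fromCols, fromRows_mul] at hopt
  simp only [add_zero] at hopt
  exact ⟨F, U, hdyn, fromRows_inj hopt⟩

namespace IsClosedLoopRiccati

theorem isAntistable (h : IsClosedLoopRiccati A B Q S R P K) (hP : (-P).PosSemidef)
    (hH : (fromBlocks Q Sᵀ S R).PosDef) : IsAntistable ((A - B * K).map Complex.ofRealHom) := by
  have hinj : Function.Injective (feedbackGraph K).mulVec := fun x y hxy => by
    simpa [feedbackGraph] using congrArg (fun z => z ∘ Sum.inl) hxy
  have hW : ((feedbackGraph K)ᴴ * fromBlocks Q Sᵀ S R * feedbackGraph K).PosDef :=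
    hH.conjTranspose_mul_mul_same hinj
  have hstein : (A - B * K)ᵀ * -P * (A - B * K)
      = -P + (feedbackGraph K)ᴴ * fromBlocks Q Sᵀ S R * feedbackGraph K := by
    rw [Matrix.mul_neg, Matrix.neg_mul, h.transpose_sub_mul_mul_sub,
      conjTranspose_eq_transpose_of_trivial]
    abel
  refine .of_stein (posSemidef_map_ofReal hP) (posDef_map_ofReal hW) ?_
  rw [conjTranspose_map_ofReal, ← Matrix.map_mul, ← Matrix.map_mul, hstein]
  exact Matrix.map_add _ (map_add _) _ _

theorem eq_of_isAntistable (h : IsClosedLoopRiccati A B Q S R P K)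
    (h' : IsClosedLoopRiccati A B Q S R P' K') (hQ : Q.IsSymm) (hR : R.IsSymm) (hP : P.IsSymm)
    (hK : IsAntistable ((A - B * K).map Complex.ofRealHom))
    (hK' : IsAntistable ((A - B * K').map Complex.ofRealHom)) : P = P' := by
  have hsub := congrArg (·.map Complex.ofRealHom) (h.sub_eq_transpose_mul_sub_mul h' hQ hR hP)
  simp only [Matrix.map_mul, ← conjTranspose_map_ofReal] at hsub
  have hzero := hK.conjTranspose.eq_zero_of_eq_mul_mul hK' hsub
  exact sub_eq_zero.1 (Matrix.map_injective Complex.ofRealHom.injective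
    (hzero.trans (Matrix.map_zero _ (map_zero _)).symm))

end IsClosedLoopRiccati

end RealRiccati

section Dare

variable {n m : ℕ} {A : Matrix (Fin n) (Fin n) ℝ} {B : Matrix (Fin n) (Fin m) ℝ}
  {Q : Matrix (Fin n) (Fin n) ℝ} {S : Matrix (Fin m) (Fin n) ℝ} {R : Matrix (Fin m) (Fin m) ℝ}
  {P P' : Matrix (Fin n) (Fin n) ℝ} {K : Matrix (Fin m) (Fin n) ℝ}

theorem IsDARESolution.isClosedLoopRiccati (h : IsDARESolution A B Q S R P) :
    IsClosedLoopRiccati A B Q S R P (dareGain A B S R P) := by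
  have hgain : (R + Bᵀ * P * B) * dareGain A B S R P = S + Bᵀ * P * A :=
    mul_nonsing_inv_cancel_left _ _ ((isUnit_iff_isUnit_det _).1 h.isUnit)
  refine ⟨?_, h.eq.trans ?_⟩
  · rw [Matrix.mul_sub, ← add_sub_assoc, ← hgain, Matrix.add_mul]
    simp only [Matrix.mul_assoc]
    abel
  · simp only [Matrix.mul_sub, Matrix.add_mul, Matrix.mul_assoc]
    abel

namespace IsClosedLoopRiccati

theorem dareGain_eq (h : IsClosedLoopRiccati A B Q S R P K) (hP : IsUnit (R + Bᵀ * P * B)) :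
    dareGain A B S R P = K := by
  have hgain : S + Bᵀ * P * A = (R + Bᵀ * P * B) * K := by
    rw [Matrix.add_mul, h.stationary]
    simp only [Matrix.mul_sub, Matrix.mul_assoc]
    abel
  rw [dareGain, hgain, nonsing_inv_mul_cancel_left _ _ ((isUnit_iff_isUnit_det _).1 hP)]

theorem isAntistabilizingDARESolution (h : IsClosedLoopRiccati A B Q S R P K) (hP : P.IsSymm)
    (hM : IsUnit (fromBlocks A B S R))
    (hK : IsAntistable ((A - B * K).map Complex.ofRealHom)) :
    IsAntistabilizingDARESolution A B Q S R P := by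
  have hgain := h.dareGain_eq (h.isUnit hM)
  refine ⟨⟨hP, h.isUnit hM, h.cost.trans ?_⟩, by rw [hgain]; exact hK⟩
  rw [hgain]
  simp only [Matrix.mul_sub, Matrix.add_mul, Matrix.mul_assoc]
  abel

end IsClosedLoopRiccati

theorem IsAntistabilizingDARESolution.eq (h : IsAntistabilizingDARESolution A B Q S R P)
    (h' : IsAntistabilizingDARESolution A B Q S R P') (hQ : Q.IsSymm) (hR : R.IsSymm) : P = P' :=
  h.solution.isClosedLoopRiccati.eq_of_isAntistable h'.solution.isClosedLoopRiccati hQ hR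
    h.solution.symm h.outside h'.outside

theorem IsControllable.exists_isClosedLoopRiccati_isAntistable (hctrl : IsControllable A B)
    (hM : IsUnit (fromBlocks A B S R)) (hH : (fromBlocks Q Sᵀ S R).PosDef) :
    ∃ P K, IsClosedLoopRiccati A B Q S R P K ∧ P.IsSymm ∧
      IsAntistable ((A - B * K).map Complex.ofRealHom) := by
  have hR : R.IsSymm := isHermitian_iff_isSymm.1 (isHermitian_fromBlocks_iff.1 hH.isHermitian).2.2.2
  obtain ⟨V, hV, hfix⟩ := hctrl.exists_posSemidef_eq_bellman hH
  obtain ⟨F, U, hdyn, hcost, hstat⟩ :=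
    exists_optimality_of_eq_bellman hH hctrl.injective_vecMul_fromCols hV hfix
  obtain ⟨K, hK⟩ := exists_isClosedLoopRiccati_neg hR hM hdyn hcost hstat
  exact ⟨-V, K, hK, (isHermitian_iff_isSymm.1 hV.isHermitian).neg,
    hK.isAntistable (by rwa [neg_neg]) hH⟩

theorem rotatedCost_eq_fromBlocks {L : Matrix (Fin n) (Fin n) ℝ} (hL : L.IsSymm) :
    rotatedCost A B Q S R L = fromBlocks (Q + L - Aᵀ * L * A) (S - Bᵀ * L * A)ᵀ (S - Bᵀ * L * A)
      (R - Bᵀ * L * B) := by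
  simp only [rotatedCost, transpose_sub, transpose_mul, transpose_transpose, hL.eq,
    Matrix.mul_assoc]

theorem transpose_rotatedCost (hQ : Q.IsSymm) (hR : R.IsSymm) (L : Matrix (Fin n) (Fin n) ℝ) :
    (rotatedCost A B Q S R L)ᵀ = rotatedCost A B Q S R Lᵀ := by
  simp only [rotatedCost, fromBlocks_transpose, transpose_sub, transpose_add, transpose_mul,
    transpose_transpose, hQ.eq, hR.eq, Matrix.mul_assoc]

theorem rotatedCost_half_smul_add (L L' : Matrix (Fin n) (Fin n) ℝ) :
    rotatedCost A B Q S R ((1 / 2 : ℝ) • (L + L'))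
      = (1 / 2 : ℝ) • (rotatedCost A B Q S R L + rotatedCost A B Q S R L') := by
  simp only [rotatedCost, fromBlocks_add, fromBlocks_smul, Matrix.mul_smul, Matrix.smul_mul,
    Matrix.mul_add, Matrix.add_mul]
  congr 1 <;> module

theorem QuadStrictPreDissipative.exists_isSymm_posDef (h : QuadStrictPreDissipative A B Q S R)
    (hQ : Q.IsSymm) (hR : R.IsSymm) :
    ∃ L : Matrix (Fin n) (Fin n) ℝ, L.IsSymm ∧ (rotatedCost A B Q S R L).PosDef := by
  obtain ⟨L, ε, hε, hL⟩ := h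
  have hpos : ∀ z ≠ 0, 0 < z ⬝ᵥ (rotatedCost A B Q S R L *ᵥ z) := fun z hz => by
    have hzz : 0 < z ⬝ᵥ z := by simpa using dotProduct_star_self_pos_iff.2 hz
    have hle := hL (z ∘ Sum.inl) (z ∘ Sum.inr)
    rw [← sumElim_dotProduct_sumElim, Sum.elim_comp_inl_inr] at hle
    exact (mul_pos hε hzz).trans_le hle
  refine ⟨(1 / 2 : ℝ) • (L + Lᵀ), by simp [IsSymm, add_comm], ?_⟩
  rw [rotatedCost_half_smul_add, ← transpose_rotatedCost hQ hR]
  exact posDef_half_smul_add_transpose hpos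

end Dare

theorem mainTheorem6 {n m : ℕ}
    (A : Matrix (Fin n) (Fin n) ℝ) (B : Matrix (Fin n) (Fin m) ℝ)
    (Q : Matrix (Fin n) (Fin n) ℝ) (S : Matrix (Fin m) (Fin n) ℝ)
    (R : Matrix (Fin m) (Fin m) ℝ)
    (hQ : Q.IsSymm) (hR : R.IsSymm)
    (hctrl : IsControllable A B)
    (hdiss : QuadStrictPreDissipative A B Q S R)
    (K : Matrix (Fin m) (Fin n) ℝ)
    (hAK : IsUnit (A - B * K))
    (hD : IsUnit (R - (S - R * K) * (A - B * K)⁻¹ * B)) :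
    ∃! P : Matrix (Fin n) (Fin n) ℝ, IsAntistabilizingDARESolution A B Q S R P := by
  have hM : IsUnit (fromBlocks A B S R) := isUnit_fromBlocks_of_feedback hAK hD
  obtain ⟨L, hL, hH⟩ := hdiss.exists_isSymm_posDef hQ hR
  rw [rotatedCost_eq_fromBlocks hL] at hH
  obtain ⟨P, G, hG, hP, hstab⟩ :=
    hctrl.exists_isClosedLoopRiccati_isAntistable (isUnit_fromBlocks_rotate L hM) hH
  have hsol : IsAntistabilizingDARESolution A B Q S R (P - L) :=
    (hG.of_rotated hL).isAntistabilizingDARESolution (hP.sub hL) hM hstab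
  exact ⟨P - L, hsol, fun P' hP' => hP'.eq hsol hQ hR⟩
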